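/- Let $(V,\langle\cdot,\cdot\rangle)$ be a pseudo-Euclidean vector space (finite-dimensional, real, with a nondegenerate symmetric bilinear form), let $E(V)=O(V)\ltimes V$ be its pseudo-Euclidean group, whose elements $E=(R,s)$ act by $Ex=Rx+s$, and let $(M,g)$ and $(\widehat M,\widehat g)$ be smooth pseudo-Riemannian manifolds isometrically embedded into $V$, with tangent spaces $T_pM\subset V$ and normal spaces $N_pM=(T_pM)^{\perp}$ (similarly for $\widehat M$). Let $I\subset\mathbb R$ be an interval with more than one point. All curves, curves of linear isometries, and vector fields along curves are smooth on $I$. A tangent vector field along a curve is *parallel* if its Levi-Civita covariant derivative along the curve vanishes; a normal vector field $Z$ along a curve is *normal parallel* if the normal component of $\dot Z(t)$ vanishes for all $t\in I$. An *extrinsic rolling (I)* of $M$ over $\widehat M$ is a quadruple $(\alpha(t),\widehat\alpha(t),A(t),C(t))$ of curves $\alpha\colon I\to M$, $\widehat\alpha\colon I\to\widehat M$ and smooth curves of linear isometries $A(t)\colon T_{\alpha(t)}M\to T_{\widehat\alpha(t)}\widehat M$ and $C(t)\colon N_{\alpha(t)}M\to N_{\widehat\alpha(t)}\widehat M$ such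 that 1. $\dot{\widehat\alpha}(t)=A(t)\dot\alpha(t)$; 2. $A(t)X(t)$ is parallel along $\widehat\alpha$ if and only if $X(t)$ is parallel along $\alpha$, for tangent vector fields $X$ along $\alpha$; 3. $C(t)Z(t)$ is normal parallel along $\widehat\alpha$ if and only if $Z(t)$ is normal parallel along $\alpha$, for normal vector fields $Z$ along $\alpha$. An *extrinsic rolling (II)* of $M$ over $\widehat M$ is a curve $(\alpha,E)=(\alpha,(R,s))\colon I\to M\times E(V)$ such that 1. $\widehat\alpha(t):=E(t)\alpha(t)\in\widehat M$; 2. $d_{\alpha(t)}E(t)\,(T_{\alpha(t)}M)=T_{\widehat\alpha(t)}\widehat M$; 3. $\dot{\widehat\alpha}(t)=d_{\alpha(t)}E(t)\,\dot\alpha(t)$; 4. $d_{\alpha(t)}E(t)X(t)$ is parallel along $\widehat\alpha$ if and only if $X$ is parallel along $\alpha$, for tangent vector fields $X$ along $\alpha$; 5. $d_{\alpha(t)}E(t)Z(t)$ is normal parallel along $\widehat\alpha$ if and only if $Z$ is normal parallel along $\alpha$, for normal vector fields $Z$ along $\alpha$. **Proposition.** If $(\alpha,\widehat\alpha,A,C)$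 is an extrinsic rolling (I), then the formulas $$R(t)|_{T_{\alpha(t)}M}=A(t),\qquad R(t)|_{N_{\alpha(t)}M}=C(t),\qquad s(t)=\widehat\alpha(t)-R(t)\alpha(t)$$ determine a unique curve $(R,s)$ in $E(V)$ on $I$, and $(\alpha,(R,s))$ is an extrinsic rolling (II). Conversely, if $(\alpha,(R,s))$ is an extrinsic rolling (II), then the formulas $$A(t)=R(t)|_{T_{\alpha(t)}M},\qquad C(t)=R(t)|_{N_{\alpha(t)}M},\qquad \widehat\alpha(t)=s(t)+R(t)\alpha(t)$$ determine a unique quadruple $(\alpha,\widehat\alpha,A,C)$ on $I$, and it is an extrinsic rolling (I). In particular, the two constructions are inverse to each other. -/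

import Mathlib

open Set
open scoped Manifold ContDiff Topology

/-! Pseudo-Riemannian manifolds -/

/-- A smooth pseudo-Riemannian metric on a manifold `M` modelled on `E`: a smooth field of
symmetric nondegenerate bilinear forms on the tangent spaces. -/
structure PseudoRiemannianMetric (E : Type*) [NormedAddCommGroup E] [NormedSpace ℝ E]
    (M : Type*) [TopologicalSpace M] [ChartedSpace E M] [IsManifold 𝓘(ℝ, E) ∞ M] where
  form (p : M) : TangentSpace 𝓘(ℝ, E) p →L[ℝ] TangentSpace 𝓘(ℝ, E) p →L[ℝ] ℝ
  symm (p : M) (u v : TangentSpace 𝓘(ℝ, E) p) : form p u v = form p v u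
  nondegenerate (p : M) (u : TangentSpace 𝓘(ℝ, E) p) (hu : ∀ v, form p u v = 0) : u = 0
  contMDiff : ContMDiff 𝓘(ℝ, E) (𝓘(ℝ, E).prod 𝓘(ℝ, E →L[ℝ] E →L[ℝ] ℝ)) ∞
    (fun p ↦ Bundle.TotalSpace.mk' (E →L[ℝ] E →L[ℝ] ℝ)
      (E := fun p : M ↦ TangentSpace 𝓘(ℝ, E) p →L[ℝ] TangentSpace 𝓘(ℝ, E) p →L[ℝ] ℝ)
      p (form p))

noncomputable section CurvesInManifolds

variable {E : Type*} [NormedAddCommGroup E] [NormedSpace ℝ E]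
  {M : Type*} [TopologicalSpace M] [ChartedSpace E M]

/-- `α` is a smooth curve in `M` on the set `J` of parameters; its values off `J` are irrelevant. -/
def IsSmoothCurve (E : Type*) [NormedAddCommGroup E] [NormedSpace ℝ E]
    {M : Type*} [TopologicalSpace M] [ChartedSpace E M] (J : Set ℝ) (α : ℝ → M) : Prop :=
  ContMDiffOn 𝓘(ℝ, ℝ) 𝓘(ℝ, E) ∞ α J

/-- The velocity of the curve `α` at the parameter `t ∈ J` (one-sided at an end point of `J`). -/
def velocity (E : Type*) [NormedAddCommGroup E] [NormedSpace ℝ E]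
    {M : Type*} [TopologicalSpace M] [ChartedSpace E M] (J : Set ℝ) (α : ℝ → M) (t : ℝ) :
    TangentSpace 𝓘(ℝ, E) (α t) :=
  mfderivWithin 𝓘(ℝ, ℝ) 𝓘(ℝ, E) α J t (1 : ℝ)

variable [IsManifold 𝓘(ℝ, E) ∞ M]

/-- `X` is a smooth vector field along `α` on `J`, that is, a smooth curve in `TM` above `α`. -/
def IsSmoothFieldAlong (J : Set ℝ) (α : ℝ → M) (X : ∀ t, TangentSpace 𝓘(ℝ, E) (α t)) : Prop :=
  ContMDiffOn 𝓘(ℝ, ℝ) 𝓘(ℝ, E).tangent ∞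
    (fun t ↦ (⟨α t, X t⟩ : TangentBundle 𝓘(ℝ, E) M)) J

namespace PseudoRiemannianMetric

variable (g : PseudoRiemannianMetric E M)

/-- The metric read in the preferred chart at `p`: the bilinear form at the point `x` of the
chart's target, applied to `u` and `w`. -/
def inChart (p : M) (x u w : E) : ℝ :=
  g.form ((chartAt E p).symm x)
    (mfderiv 𝓘(ℝ, E) 𝓘(ℝ, E) (chartAt E p).symm x u)
    (mfderiv 𝓘(ℝ, E) 𝓘(ℝ, E) (chartAt E p).symm x w)

/-- Christoffel symbols of the first kind of the Levi-Civita connection in the preferred chart at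
`p`: `½ (∂_u g(v, w) + ∂_v g(u, w) - ∂_w g(u, v))` at `x`, for constant fields `u, v, w`. -/
def christoffel (p : M) (x u v w : E) : ℝ :=
  (1 / 2 : ℝ) * (fderiv ℝ (fun y ↦ g.inChart p y v w) x u
    + fderiv ℝ (fun y ↦ g.inChart p y u w) x v
    - fderiv ℝ (fun y ↦ g.inChart p y u v) x w)

/-- The Levi-Civita covariant derivative `∇_{α'} X` at `t`, in the preferred chart at `α t`,
paired by the metric with `w`: with `x` and `ξ` the coordinate expressions of `α` and `X`, this is
`g(ξ', w) + Γ(x', ξ, w)`. -/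
def covDerivPairing (J : Set ℝ) (α : ℝ → M) (X : ∀ t, TangentSpace 𝓘(ℝ, E) (α t)) (t : ℝ)
    (w : E) : ℝ :=
  let x : ℝ → E := fun τ ↦ chartAt E (α t) (α τ)
  let ξ : ℝ → E := fun τ ↦ mfderiv 𝓘(ℝ, E) 𝓘(ℝ, E) (chartAt E (α t)) (α τ) (X τ)
  g.inChart (α t) (x t) (derivWithin ξ J t) w
    + g.christoffel (α t) (x t) (derivWithin x J t) (ξ t) w

/-- `X` is a parallel vector field along `α` on `J` for the Levi-Civita connection of `g`.
As `g` is nondegenerate, `∇_{α'} X` vanishes iff its pairing with every vector does. -/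
def IsParallelAlong (J : Set ℝ) (α : ℝ → M) (X : ∀ t, TangentSpace 𝓘(ℝ, E) (α t)) : Prop :=
  IsSmoothFieldAlong J α X ∧ ∀ t ∈ J, ∀ w : E, g.covDerivPairing J α X t w = 0

end PseudoRiemannianMetric

end CurvesInManifolds

/-! Isometric embeddings into a pseudo-Euclidean vector space `(V, B)` -/

noncomputable section Embeddings

variable {V : Type*} [NormedAddCommGroup V] [NormedSpace ℝ V]
  {E : Type*} [NormedAddCommGroup E] [NormedSpace ℝ E]
  {M : Type*} [TopologicalSpace M] [ChartedSpace E M]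

/-- The differential `T_p M → V` of a map `ι : M → V` into a vector space. -/
def embDeriv (ι : M → V) (p : M) : TangentSpace 𝓘(ℝ, E) p →L[ℝ] V :=
  mfderiv 𝓘(ℝ, E) 𝓘(ℝ, V) ι p

/-- `ι` is a smooth embedding which pulls the scalar product `B` of `V` back to `g`. -/
structure IsIsometricEmbedding [IsManifold 𝓘(ℝ, E) ∞ M] (g : PseudoRiemannianMetric E M)
    (B : LinearMap.BilinForm ℝ V) (ι : M → V) : Prop where
  isSmoothEmbedding : Manifold.IsSmoothEmbedding 𝓘(ℝ, E) 𝓘(ℝ, V) ∞ ι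
  isometric (p : M) (u v : TangentSpace 𝓘(ℝ, E) p) :
    B (embDeriv ι p u) (embDeriv ι p v) = g.form p u v

/-- The tangent space `T_p M`, as a subspace of `V`. -/
def tangentSub (E : Type*) [NormedAddCommGroup E] [NormedSpace ℝ E]
    {M : Type*} [TopologicalSpace M] [ChartedSpace E M] (ι : M → V) (p : M) : Submodule ℝ V :=
  LinearMap.range (embDeriv (E := E) ι p).toLinearMap

/-- The normal space `N_p M`, the orthogonal complement of `T_p M` in `V`. -/
def normalSub (E : Type*) [NormedAddCommGroup E] [NormedSpace ℝ E]
    {M : Type*} [TopologicalSpace M] [ChartedSpace E M] (B : LinearMap.BilinForm ℝ V)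
    (ι : M → V) (p : M) : Submodule ℝ V :=
  B.orthogonal (tangentSub E ι p)

/-- `Z` is a normal parallel vector field along `α` on `J`: it is smooth, has values in the normal
spaces, and its normal covariant derivative, the normal component of `Z'(t)` in
`V = T_{α t} M ⊕ N_{α t} M`, vanishes; that is, `Z'(t)` is tangent. -/
def IsNormalParallelAlong (E : Type*) [NormedAddCommGroup E] [NormedSpace ℝ E]
    {M : Type*} [TopologicalSpace M] [ChartedSpace E M] (B : LinearMap.BilinForm ℝ V)
    (ι : M → V) (J : Set ℝ) (α : ℝ → M) (Z : ℝ → V) : Prop :=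
  ContDiffOn ℝ ∞ Z J ∧ (∀ t ∈ J, Z t ∈ normalSub E B ι (α t)) ∧
    ∀ t ∈ J, derivWithin Z J t ∈ tangentSub E ι (α t)

end Embeddings

/-! The pseudo-Euclidean group -/

/-- An element `(R, s)` of the pseudo-Euclidean group `E(V) = O(V) ⋉ V` of `(V, B)`. -/
@[ext]
structure PseudoEuclideanMotion {V : Type*} [AddCommGroup V] [Module ℝ V]
    (B : LinearMap.BilinForm ℝ V) where
  rot : B.IsometryEquiv B
  trans : V

namespace PseudoEuclideanMotion

variable {V : Type*} [NormedAddCommGroup V] [NormedSpace ℝ V] {B : LinearMap.BilinForm ℝ V}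

/-- The action of `E(V)` on `V`: `(R, s)` maps `v` to `R v + s`. -/
def act (F : PseudoEuclideanMotion B) (v : V) : V := F.rot v + F.trans

/-- The differential at `v` of the action of a motion. -/
noncomputable def diff (F : PseudoEuclideanMotion B) (v : V) : V →L[ℝ] V := fderiv ℝ F.act v

/-- The curve `F = (R, s)` in `E(V)` is smooth on `J`: `s` is smooth, and so is `R` as a curve of
linear maps, that is, `R t v` is smooth in `t` for each `v`. -/
def IsSmoothCurve (J : Set ℝ) (F : ℝ → PseudoEuclideanMotion B) : Prop :=
  (∀ v : V, ContDiffOn ℝ ∞ (fun t ↦ (F t).rot v) J) ∧ ContDiffOn ℝ ∞ (fun t ↦ (F t).trans) J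

end PseudoEuclideanMotion

/-! The two notions of extrinsic rolling -/

section Rolling

variable {V : Type*} [NormedAddCommGroup V] [NormedSpace ℝ V]
  {E : Type*} [NormedAddCommGroup E] [NormedSpace ℝ E]
  {E' : Type*} [NormedAddCommGroup E'] [NormedSpace ℝ E']
  {M : Type*} [TopologicalSpace M] [ChartedSpace E M] [IsManifold 𝓘(ℝ, E) ∞ M]
  {M' : Type*} [TopologicalSpace M'] [ChartedSpace E' M'] [IsManifold 𝓘(ℝ, E') ∞ M']

/-- Extrinsic rolling (I) of `M` over `M'`: a quadruple `(α, α', A, C)` of smooth curves on `J`,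
where `A t : T_{α t} M → T_{α' t} M'` and `C t : N_{α t} M → N_{α' t} M'` are linear isometries.
Smoothness of `A` (of `C`) means that it maps smooth tangent (normal) vector fields along `α` to
smooth vector fields along `α'`. -/
structure IsExtrinsicRollingI (B : LinearMap.BilinForm ℝ V)
    (g : PseudoRiemannianMetric E M) (g' : PseudoRiemannianMetric E' M')
    (ι : M → V) (ι' : M' → V) (J : Set ℝ) (α : ℝ → M) (α' : ℝ → M')
    (A : ∀ t, TangentSpace 𝓘(ℝ, E) (α t) →ₗ[ℝ] TangentSpace 𝓘(ℝ, E') (α' t))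
    (C : ∀ t, normalSub E B ι (α t) →ₗ[ℝ] normalSub E' B ι' (α' t)) : Prop where
  smooth_curve : IsSmoothCurve E J α
  smooth_development : IsSmoothCurve E' J α'
  smooth_tangent (X : ∀ t, TangentSpace 𝓘(ℝ, E) (α t)) (hX : IsSmoothFieldAlong J α X) :
    IsSmoothFieldAlong J α' (fun t ↦ A t (X t))
  smooth_normal (Z : ∀ t, normalSub E B ι (α t)) (hZ : ContDiffOn ℝ ∞ (fun t ↦ (Z t : V)) J) :
    ContDiffOn ℝ ∞ (fun t ↦ (C t (Z t) : V)) J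
  bijective_tangent : ∀ t ∈ J, Function.Bijective (A t)
  isometric_tangent : ∀ t ∈ J, ∀ u v, g'.form (α' t) (A t u) (A t v) = g.form (α t) u v
  bijective_normal : ∀ t ∈ J, Function.Bijective (C t)
  isometric_normal : ∀ t ∈ J, ∀ y z, B (C t y) (C t z) = B y z
  no_slip : ∀ t ∈ J, velocity E' J α' t = A t (velocity E J α t)
  no_twist_tangent (X : ∀ t, TangentSpace 𝓘(ℝ, E) (α t)) :
    g'.IsParallelAlong J α' (fun t ↦ A t (X t)) ↔ g.IsParallelAlong J α X
  no_twist_normal (Z : ∀ t, normalSub E B ι (α t)) :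
    IsNormalParallelAlong E' B ι' J α' (fun t ↦ (C t (Z t) : V)) ↔
      IsNormalParallelAlong E B ι J α (fun t ↦ (Z t : V))

/-- The conditions of extrinsic rolling (II) on a curve `(α, F)` in `M × E(V)` whose development
curve `F(t) α(t)` is the curve `α'` of `M'`. A vector field `X` along `α` is carried to the vector
field `X'` along `α'` with the same image in `V` as `d F(t) X(t)`. -/
structure IsExtrinsicRollingIIWith (B : LinearMap.BilinForm ℝ V)
    (g : PseudoRiemannianMetric E M) (g' : PseudoRiemannianMetric E' M')
    (ι : M → V) (ι' : M' → V) (J : Set ℝ) (α : ℝ → M) (F : ℝ → PseudoEuclideanMotion B)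
    (α' : ℝ → M') : Prop where
  smooth_curve : IsSmoothCurve E J α
  smooth_motion : PseudoEuclideanMotion.IsSmoothCurve J F
  development : ∀ t ∈ J, ι' (α' t) = (F t).act (ι (α t))
  map_tangent : ∀ t ∈ J,
    (tangentSub E ι (α t)).map ((F t).diff (ι (α t))).toLinearMap = tangentSub E' ι' (α' t)
  no_slip : ∀ t ∈ J, embDeriv ι' (α' t) (velocity E' J α' t) =
    (F t).diff (ι (α t)) (embDeriv ι (α t) (velocity E J α t))
  no_twist_tangent (X : ∀ t, TangentSpace 𝓘(ℝ, E) (α t))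
    (X' : ∀ t, TangentSpace 𝓘(ℝ, E') (α' t))
    (hX : ∀ t ∈ J, embDeriv ι' (α' t) (X' t) =
      (F t).diff (ι (α t)) (embDeriv ι (α t) (X t))) :
    g'.IsParallelAlong J α' X' ↔ g.IsParallelAlong J α X
  no_twist_normal (Z : ∀ t, normalSub E B ι (α t)) :
    IsNormalParallelAlong E' B ι' J α' (fun t ↦ (F t).diff (ι (α t)) (Z t : V)) ↔
      IsNormalParallelAlong E B ι J α (fun t ↦ (Z t : V))

/-- Extrinsic rolling (II) of `M` over `M'`: a curve `(α, F)` in `M × E(V)` such that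
`F(t) α(t)` lies in `M'`, defining there the development curve, and the remaining conditions hold.
The development curve is unique on `J` because `ι'` is injective. -/
def IsExtrinsicRollingII (B : LinearMap.BilinForm ℝ V)
    (g : PseudoRiemannianMetric E M) (g' : PseudoRiemannianMetric E' M')
    (ι : M → V) (ι' : M' → V) (J : Set ℝ) (α : ℝ → M) (F : ℝ → PseudoEuclideanMotion B) : Prop :=
  ∃ α' : ℝ → M', IsExtrinsicRollingIIWith B g g' ι ι' J α F α'

/-- The formulas relating `(α, α', A, C)` and `(α, (R, s))` on `J`: `R` restricts to `A` on the
tangent spaces and to `C` on the normal spaces, and `s = α' - R α`. -/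
structure RollingsCorrespond (B : LinearMap.BilinForm ℝ V)
    (ι : M → V) (ι' : M' → V) (J : Set ℝ) (α : ℝ → M) (α' : ℝ → M')
    (A : ∀ t, TangentSpace 𝓘(ℝ, E) (α t) →ₗ[ℝ] TangentSpace 𝓘(ℝ, E') (α' t))
    (C : ∀ t, normalSub E B ι (α t) →ₗ[ℝ] normalSub E' B ι' (α' t))
    (F : ℝ → PseudoEuclideanMotion B) : Prop where
  tangent : ∀ t ∈ J, ∀ u, (F t).rot (embDeriv ι (α t) u) = embDeriv ι' (α' t) (A t u)
  normal : ∀ t ∈ J, ∀ z : normalSub E B ι (α t), (F t).rot (z : V) = (C t z : V)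
  translation : ∀ t ∈ J, (F t).trans = ι' (α' t) - (F t).rot (ι (α t))

end Rolling

/-!
The metrics of `M` and `M'` are the restrictions of the scalar product `B` of `V`, so `B` is
nondegenerate on every tangent space and `V` is the orthogonal sum of the tangent and the normal
space at each point. Hence isometries `A t` of the tangent spaces and `C t` of the normal spaces
glue to a unique isometry `R t` of `V` (`IsIsometricEmbedding.exists_isometryEquiv`,
`RollingsCorrespond.eqOn_motion`). Conversely, an isometry of `V` that maps a tangent space onto a
tangent space maps the normal space onto the normal space, so that it restricts to both
(`IsExtrinsicRollingIIWith.exists_quadruple`), and injectivity of `ι'` and of its differentials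
makes the restrictions unique.

Once `R t` restricts to `A t` and `C t`, the no-slip and no-twist conditions of the two notions are
literally the same conditions on fields, written in `M'` or in `V`; no formula for the covariant
derivative is needed. What remains is smoothness, which passes between the manifolds and `V` by two
facts:

* a curve in `M'` is smooth once its image in `V` is (`isSmoothCurve_of_contDiffOn_embedding`), by
  the normal form of an immersion;
* a tangent field whose scalar products with tangent vectors are those of a smooth curve in `V` is
  smooth (`IsIsometricEmbedding.isSmoothFieldAlong_of_pairing`), by inverting the Gram matrix of a
  local frame. It applies both to the tangential component of a curve in `V`, which makes `R`
  smooth if `A` and `C` are, and to a field with smooth image in `V`, which makes `A` smooth if `R`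
  is.
-/

/-! ### Smooth curves and fields, seen in the ambient space -/

section SmoothFields

variable {V : Type*} [NormedAddCommGroup V] [NormedSpace ℝ V]
  {E : Type*} [NormedAddCommGroup E] [NormedSpace ℝ E]
  {M : Type*} [TopologicalSpace M] [ChartedSpace E M]

/-- A curve is smooth as soon as its image under a smooth embedding is: in the charts of an
immersion the embedding reads `u ↦ (u, 0)`, which has the smooth left inverse `Prod.fst`. -/
theorem isSmoothCurve_of_contDiffOn_embedding {ι : M → V}
    (hι : Manifold.IsSmoothEmbedding 𝓘(ℝ, E) 𝓘(ℝ, V) ∞ ι) {J : Set ℝ} {β : ℝ → M}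
    (hβ : ContDiffOn ℝ ∞ (fun t ↦ ι (β t)) J) : IsSmoothCurve E J β := by
  intro t ht
  have hcont : ContinuousWithinAt β J t := by
    have := hβ.continuousOn t ht
    rw [ContinuousWithinAt, hι.isEmbedding.isInducing.nhds_eq_comap, Filter.tendsto_comap_iff]
    exact this
  have h := hι.isImmersion.isImmersionAt (β t)
  have hcod : ContMDiffWithinAt 𝓘(ℝ, ℝ) 𝓘(ℝ, V) ∞ (fun τ ↦ h.codChart (ι (β τ))) J t :=
    (contMDiffAt_of_mem_maximalAtlas h.codChart_mem_maximalAtlas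
      h.mem_codChart_source).comp_contMDiffWithinAt t (hβ.contMDiffOn t ht)
  have hproj : ContMDiff 𝓘(ℝ, V) 𝓘(ℝ, E) ∞ (fun v ↦ (h.equiv.symm v).1) :=
    ContDiff.contMDiff (by fun_prop)
  have hdom : ContMDiffAt 𝓘(ℝ, E) 𝓘(ℝ, E) ∞ h.domChart.symm (h.domChart (β t)) :=
    contMDiffAt_symm_of_mem_maximalAtlas h.domChart_mem_maximalAtlas
      (h.domChart.map_source h.mem_domChart_source)
  -- In the charts of the immersion, `Prod.fst` undoes `ι`.
  have key : ∀ p ∈ h.domChart.source, (h.equiv.symm (h.codChart (ι p))).1 = h.domChart p := by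
    intro p hp
    have hmem : h.domChart p ∈ (h.domChart.extend 𝓘(ℝ, E)).target := by
      simpa using h.domChart.map_source hp
    have := h.writtenInCharts hmem
    simp only [Function.comp_apply, OpenPartialHomeomorph.extend_coe,
      OpenPartialHomeomorph.extend_coe_symm, modelWithCornersSelf_coe, id_eq,
      modelWithCornersSelf_coe_symm, h.domChart.left_inv hp] at this
    rw [this]; simp
  have h1 : ContMDiffWithinAt 𝓘(ℝ, ℝ) 𝓘(ℝ, E) ∞
      (fun τ ↦ (h.equiv.symm (h.codChart (ι (β τ)))).1) J t :=
    hproj.contMDiffAt.comp_contMDiffWithinAt t hcod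
  rw [← key _ h.mem_domChart_source] at hdom
  have h2 := hdom.comp_contMDiffWithinAt t h1
  refine h2.congr_of_eventuallyEq ?_ ?_
  · filter_upwards [hcont (h.domChart.open_source.mem_nhds h.mem_domChart_source)] with τ hτ
    simp only [Function.comp_apply]
    rw [key _ hτ, h.domChart.left_inv hτ]
  · simp only [Function.comp_apply]
    rw [key _ h.mem_domChart_source, h.domChart.left_inv h.mem_domChart_source]

variable [IsManifold 𝓘(ℝ, E) ∞ M]

/-- As a curve in `V`, a smooth field is its composition with the tangent map of `ι`, followed by
`TV → V`. -/
theorem IsSmoothFieldAlong.contDiffOn_embDeriv {ι : M → V}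
    (hι : ContMDiff 𝓘(ℝ, E) 𝓘(ℝ, V) ∞ ι) {J : Set ℝ} {α : ℝ → M}
    {X : ∀ t, TangentSpace 𝓘(ℝ, E) (α t)} (hX : IsSmoothFieldAlong J α X) :
    ContDiffOn ℝ ∞ (fun t ↦ embDeriv ι (α t) (X t)) J :=
  ((contMDiff_snd_tangentBundle_modelSpace V 𝓘(ℝ, V)).comp
    (hι.contMDiff_tangentMap (m := ∞) (by simp))).comp_contMDiffOn hX |>.contDiffOn

/-- The fields of a local frame are smooth along a smooth curve, as curves in the ambient space.
The frame is the image of constant vectors under the inverse of a trivialization of `TM`. -/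
theorem contDiffOn_embDeriv_symmL {ι : M → V}
    (hι : ContMDiff 𝓘(ℝ, E) 𝓘(ℝ, V) ∞ ι) {S : Set ℝ} {α : ℝ → M} (hα : IsSmoothCurve E S α)
    (p : M) (hS : ∀ t ∈ S, α t ∈ (trivializationAt E (TangentSpace 𝓘(ℝ, E)) p).baseSet) (u : E) :
    ContDiffOn ℝ ∞ (fun t ↦ embDeriv ι (α t)
      ((trivializationAt E (TangentSpace 𝓘(ℝ, E)) p).symmL ℝ (α t) u)) S := by
  refine IsSmoothFieldAlong.contDiffOn_embDeriv hι ?_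
  set e := trivializationAt E (TangentSpace 𝓘(ℝ, E)) p
  refine (e.contMDiffOn_iff ?_).2 ⟨hα, ?_⟩
  · intro t ht
    exact e.mem_source.2 (hS t ht)
  · refine contMDiffOn_const (c := u) |>.congr fun t ht ↦ ?_
    have := e.continuousLinearMapAt_symmL (R := ℝ) (hS t ht) u
    rwa [e.continuousLinearMapAt_apply ℝ, e.linearMapAt_apply, if_pos (hS t ht)] at this

end SmoothFields

/-! ### The tangential projection -/

section Projection

variable {V : Type*} [NormedAddCommGroup V] [NormedSpace ℝ V]
  {E : Type*} [NormedAddCommGroup E] [NormedSpace ℝ E]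
  {M : Type*} [TopologicalSpace M] [ChartedSpace E M] [IsManifold 𝓘(ℝ, E) ∞ M]
  {g : PseudoRiemannianMetric E M} {B : LinearMap.BilinForm ℝ V} {ι : M → V}

namespace IsIsometricEmbedding

/-- The scalar product of `V` is nondegenerate on each tangent space, since it restricts to `g`. -/
theorem eq_zero_of_pairing (hι : IsIsometricEmbedding g B ι) (p : M)
    {u : TangentSpace 𝓘(ℝ, E) p} (hu : ∀ w : TangentSpace 𝓘(ℝ, E) p,
      B (embDeriv ι p u) (embDeriv ι p w) = 0) : u = 0 :=
  g.nondegenerate p u fun w ↦ by rw [← hι.isometric, hu]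

theorem embDeriv_injective (hι : IsIsometricEmbedding g B ι) (p : M) :
    Function.Injective (embDeriv (E := E) ι p) := by
  refine (injective_iff_map_eq_zero _).2 fun u hu ↦ hι.eq_zero_of_pairing p fun w ↦ ?_
  rw [hu, map_zero, LinearMap.zero_apply]

/-- The restriction of `B` to the tangent space at `p`, as a linear isomorphism of the tangent space
onto its dual. -/
noncomputable def gramEquiv [FiniteDimensional ℝ E] (hι : IsIsometricEmbedding g B ι) (p : M) :
    TangentSpace 𝓘(ℝ, E) p ≃ₗ[ℝ] Module.Dual ℝ (TangentSpace 𝓘(ℝ, E) p) :=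
  haveI : FiniteDimensional ℝ (TangentSpace 𝓘(ℝ, E) p) := inferInstanceAs (FiniteDimensional ℝ E)
  LinearEquiv.ofInjectiveOfFinrankEq
    (B.compl₁₂ (embDeriv ι p).toLinearMap (embDeriv ι p).toLinearMap)
    ((injective_iff_map_eq_zero _).2 fun _ hu ↦
      hι.eq_zero_of_pairing p fun w ↦ LinearMap.congr_fun hu w)
    Subspace.dual_finrank_eq.symm

/-- The tangential component of a vector of `V`, as an element of the abstract tangent space: the
vector that represents, for the metric at `p`, the functional `B v` restricted to the tangent
space. -/
noncomputable def tangentProj [FiniteDimensional ℝ E] (hι : IsIsometricEmbedding g B ι) (p : M) :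
    V →ₗ[ℝ] TangentSpace 𝓘(ℝ, E) p :=
  (hι.gramEquiv p).symm.toLinearMap ∘ₗ (embDeriv ι p).toLinearMap.dualMap ∘ₗ B

theorem tangentProj_pairing [FiniteDimensional ℝ E] (hι : IsIsometricEmbedding g B ι) (p : M)
    (v : V) (w : TangentSpace 𝓘(ℝ, E) p) :
    B (embDeriv ι p (hι.tangentProj p v)) (embDeriv ι p w) = B v (embDeriv ι p w) :=
  LinearMap.congr_fun ((hι.gramEquiv p).apply_symm_apply
    ((embDeriv ι p).toLinearMap.dualMap (B v))) w

/-- A tangent field along a smooth curve is smooth as soon as its scalar products with tangent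
vectors are those of a smooth curve in `V`: in a local frame, its coefficients solve a linear
system whose matrix is the (invertible) Gram matrix of the frame. -/
theorem isSmoothFieldAlong_of_pairing [FiniteDimensional ℝ V] [FiniteDimensional ℝ E]
    (hι : IsIsometricEmbedding g B ι) {J : Set ℝ} {α : ℝ → M} (hα : IsSmoothCurve E J α)
    {W : ℝ → V} (hW : ContDiffOn ℝ ∞ W J) {X : ∀ t, TangentSpace 𝓘(ℝ, E) (α t)}
    (hX : ∀ t ∈ J, ∀ w : TangentSpace 𝓘(ℝ, E) (α t),
      B (embDeriv ι (α t) (X t)) (embDeriv ι (α t) w) = B (W t) (embDeriv ι (α t) w)) :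
    IsSmoothFieldAlong J α X := by
  have : CompleteSpace E := FiniteDimensional.complete ℝ E
  have hιs := hι.isSmoothEmbedding.contMDiff
  intro t₀ ht₀
  refine Bundle.contMDiffWithinAt_totalSpace.2 ⟨hα t₀ ht₀, ?_⟩
  set e := trivializationAt E (TangentSpace 𝓘(ℝ, E)) (α t₀)
  set S := J ∩ α ⁻¹' e.baseSet
  have hSJ : S ∈ 𝓝[J] t₀ := Filter.inter_mem self_mem_nhdsWithin
    ((hα t₀ ht₀).continuousWithinAt (e.open_baseSet.mem_nhds
      (FiberBundle.mem_baseSet_trivializationAt E _ (α t₀))))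
  have ht₀S : t₀ ∈ S := mem_of_mem_nhdsWithin ht₀ hSJ
  -- `L t` is the differential of `ι` in the local frame, `G t` the Gram matrix of the frame, and
  -- `r t` the right-hand side of the system for the coefficients of `X t`.
  let Bc : V →L[ℝ] V →L[ℝ] ℝ := LinearMap.toContinuousLinearMap
    (LinearMap.toContinuousLinearMap.toLinearMap ∘ₗ B)
  let L : ℝ → E →L[ℝ] V := fun t ↦ (embDeriv ι (α t)).comp (e.symmL ℝ (α t))
  have hL (u : E) : ContDiffOn ℝ ∞ (fun t ↦ L t u) S :=
    contDiffOn_embDeriv_symmL hιs (hα.mono inter_subset_left) (α t₀) (fun t ht ↦ ht.2) u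
  let G : ℝ → E →L[ℝ] E →L[ℝ] ℝ := fun t ↦ Bc.bilinearComp (L t) (L t)
  let r : ℝ → E →L[ℝ] ℝ := fun t ↦ (Bc (W t)).comp (L t)
  have hG : ContDiffOn ℝ ∞ G S := by
    refine contDiffOn_clm_apply.2 fun u ↦ contDiffOn_clm_apply.2 fun w ↦ ?_
    exact (Bc.contDiff.comp_contDiffOn (hL u)).clm_apply (hL w)
  have hr : ContDiffOn ℝ ∞ r S := by
    refine contDiffOn_clm_apply.2 fun w ↦ ?_
    exact (Bc.contDiff.comp_contDiffOn (hW.mono inter_subset_left)).clm_apply (hL w)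
  have hsymm (t : ℝ) (ht : t ∈ S) (x : TangentSpace 𝓘(ℝ, E) (α t)) :
      e.symmL ℝ (α t) (e ⟨α t, x⟩).2 = x := by
    have := e.symmL_continuousLinearMapAt (R := ℝ) ht.2 x
    rwa [e.continuousLinearMapAt_apply ℝ, e.linearMapAt_apply, if_pos (mem_preimage.1 ht.2)] at this
  have hGinv (t : ℝ) (ht : t ∈ S) : (G t).IsInvertible := by
    have hinj : Function.Injective (G t) := by
      refine (injective_iff_map_eq_zero _).2 fun u hu ↦ ?_
      have h0 : e.symmL ℝ (α t) u = 0 := hι.eq_zero_of_pairing (α t) fun w ↦ by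
        have := DFunLike.congr_fun hu (e ⟨α t, w⟩).2
        change B (embDeriv ι (α t) (e.symmL ℝ (α t) u))
          (embDeriv ι (α t) (e.symmL ℝ (α t) (e ⟨α t, w⟩).2)) = 0 at this
        rwa [hsymm t ht] at this
      have := e.continuousLinearMapAt_symmL (R := ℝ) ht.2 u
      rw [h0, map_zero] at this
      exact this.symm
    have hfr : Module.finrank ℝ E = Module.finrank ℝ (E →L[ℝ] ℝ) := by
      rw [← (LinearMap.toContinuousLinearMap (𝕜 := ℝ) (E := E) (F' := ℝ)).finrank_eq]
      exact Subspace.dual_finrank_eq.symm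
    exact ⟨(LinearEquiv.ofInjectiveOfFinrankEq (G t).toLinearMap hinj
      hfr).toContinuousLinearEquiv, by ext; rfl⟩
  have hsys (t : ℝ) (ht : t ∈ S) : G t (e ⟨α t, X t⟩).2 = r t := by
    ext w
    change B (embDeriv ι (α t) (e.symmL ℝ (α t) (e ⟨α t, X t⟩).2))
      (embDeriv ι (α t) (e.symmL ℝ (α t) w)) = B (W t) (embDeriv ι (α t) (e.symmL ℝ (α t) w))
    rw [hsymm t ht, hX t ht.1]
  have hsol : ContDiffOn ℝ ∞ (fun t ↦ (G t).inverse (r t)) S := fun t ht ↦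
    ((hGinv t ht).contDiffAt_map_inverse.comp_contDiffWithinAt t (hG t ht)).clm_apply (hr t ht)
  have hξ : ContDiffOn ℝ ∞ (fun t ↦ (e ⟨α t, X t⟩).2) S := hsol.congr fun t ht ↦ by
    obtain ⟨T, hT⟩ := hGinv t ht
    rw [← hsys t ht, ← hT, ContinuousLinearMap.inverse_equiv]
    exact (T.symm_apply_apply _).symm
  exact ((hξ t₀ ht₀S).mono_of_mem_nhdsWithin hSJ).contMDiffWithinAt

end IsIsometricEmbedding

end Projection

/-! ### Parallel fields depend on their values on `J` only -/

section Congruence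

variable {V : Type*} [NormedAddCommGroup V] [NormedSpace ℝ V]
  {E : Type*} [NormedAddCommGroup E] [NormedSpace ℝ E]
  {M : Type*} [TopologicalSpace M] [ChartedSpace E M]

theorem isParallelAlong_congr [IsManifold 𝓘(ℝ, E) ∞ M] (g : PseudoRiemannianMetric E M)
    {J : Set ℝ} {α : ℝ → M} {X Y : ∀ t, TangentSpace 𝓘(ℝ, E) (α t)} (h : ∀ t ∈ J, X t = Y t) :
    g.IsParallelAlong J α X ↔ g.IsParallelAlong J α Y := by
  refine and_congr (contMDiffOn_congr fun t ht ↦ by rw [h t ht]) ?_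
  refine forall₂_congr fun t ht ↦ forall_congr' fun w ↦ ?_
  have hξ : EqOn (fun τ ↦ mfderiv 𝓘(ℝ, E) 𝓘(ℝ, E) (chartAt E (α t)) (α τ) (X τ))
      (fun τ ↦ mfderiv 𝓘(ℝ, E) 𝓘(ℝ, E) (chartAt E (α t)) (α τ) (Y τ)) J :=
    fun τ hτ ↦ congrArg (mfderiv 𝓘(ℝ, E) 𝓘(ℝ, E) (chartAt E (α t)) (α τ)) (h τ hτ)
  have : g.covDerivPairing J α X t w = g.covDerivPairing J α Y t w := by
    unfold PseudoRiemannianMetric.covDerivPairing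
    simp only
    rw [derivWithin_congr hξ (hξ ht), h t ht]
  rw [this]

theorem isNormalParallelAlong_congr (B : LinearMap.BilinForm ℝ V) (ι : M → V) {J : Set ℝ}
    (α : ℝ → M) {Z W : ℝ → V} (h : EqOn Z W J) :
    IsNormalParallelAlong E B ι J α Z ↔ IsNormalParallelAlong E B ι J α W := by
  refine and_congr (contDiffOn_congr h) (and_congr ?_ ?_)
  · exact forall₂_congr fun t ht ↦ by rw [h ht]
  · exact forall₂_congr fun t ht ↦ by rw [derivWithin_congr h (h ht)]

end Congruence

/-! ### Gluing tangent and normal isometries -/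

section LinearIsometries

variable {V : Type*} [NormedAddCommGroup V] [NormedSpace ℝ V]
  {E : Type*} [NormedAddCommGroup E] [NormedSpace ℝ E]
  {M : Type*} [TopologicalSpace M] [ChartedSpace E M]
  {E' : Type*} [NormedAddCommGroup E'] [NormedSpace ℝ E']
  {M' : Type*} [TopologicalSpace M'] [ChartedSpace E' M']
  {B : LinearMap.BilinForm ℝ V}

theorem mem_normalSub_iff {ι : M → V} {p : M} {z : V} :
    z ∈ normalSub E B ι p ↔ ∀ u : TangentSpace 𝓘(ℝ, E) p, B (embDeriv ι p u) z = 0 := by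
  refine LinearMap.BilinForm.mem_orthogonal_iff.trans ⟨fun h u ↦ h _ ⟨u, rfl⟩, ?_⟩
  rintro h _ ⟨u, rfl⟩
  exact h u

/-- The scalar product of `V` in the decomposition into tangential and normal components. -/
theorem bilin_tangent_add_normal (hB : B.IsSymm) {ι : M → V} {p : M} (u v : TangentSpace 𝓘(ℝ, E) p)
    (y z : normalSub E B ι p) :
    B (embDeriv ι p u + y) (embDeriv ι p v + z) = B (embDeriv ι p u) (embDeriv ι p v) + B y z := by
  have hz := mem_normalSub_iff.1 z.2 u
  have hy : B y (embDeriv ι p v) = 0 := (hB.eq _ _).trans (mem_normalSub_iff.1 y.2 v)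
  simp only [map_add, LinearMap.add_apply, hz, hy, add_zero, zero_add]

theorem PseudoEuclideanMotion.diff_apply [FiniteDimensional ℝ V] (F : PseudoEuclideanMotion B)
    (v w : V) : F.diff v w = F.rot w := by
  have h : HasFDerivAt F.act (LinearMap.toContinuousLinearMap F.rot.toLinearEquiv.toLinearMap) v :=
    (LinearMap.toContinuousLinearMap F.rot.toLinearEquiv.toLinearMap).hasFDerivAt.add_const F.trans
  rw [PseudoEuclideanMotion.diff, h.fderiv]
  rfl

namespace IsIsometricEmbedding

variable [IsManifold 𝓘(ℝ, E) ∞ M] [IsManifold 𝓘(ℝ, E') ∞ M']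
  {g : PseudoRiemannianMetric E M} {g' : PseudoRiemannianMetric E' M'} {ι : M → V} {ι' : M' → V}

theorem tangentProj_embDeriv [FiniteDimensional ℝ E] (hι : IsIsometricEmbedding g B ι) (p : M)
    (u : TangentSpace 𝓘(ℝ, E) p) : hι.tangentProj p (embDeriv ι p u) = u := by
  refine sub_eq_zero.1 (hι.eq_zero_of_pairing p fun w ↦ ?_)
  rw [map_sub, map_sub, LinearMap.sub_apply, hι.tangentProj_pairing, sub_self]

/-- The normal component of a vector of `V`: what remains after the tangential component is
subtracted. -/
noncomputable def normalProj [FiniteDimensional ℝ E] (hι : IsIsometricEmbedding g B ι)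
    (hB : B.IsSymm) (p : M) : V →ₗ[ℝ] normalSub E B ι p :=
  (LinearMap.id - (embDeriv ι p).toLinearMap ∘ₗ hι.tangentProj p).codRestrict _ fun v ↦
    mem_normalSub_iff.2 fun u ↦ by
      rw [hB.eq]
      change B (v - embDeriv ι p (hι.tangentProj p v)) (embDeriv ι p u) = 0
      rw [map_sub, LinearMap.sub_apply, hι.tangentProj_pairing, sub_self]

theorem coe_normalProj [FiniteDimensional ℝ E] (hι : IsIsometricEmbedding g B ι)
    (hB : B.IsSymm) (p : M) (v : V) :
    (hι.normalProj hB p v : V) = v - embDeriv ι p (hι.tangentProj p v) := rfl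

theorem tangentProj_add_normalProj [FiniteDimensional ℝ E] (hι : IsIsometricEmbedding g B ι)
    (hB : B.IsSymm) (p : M) (v : V) :
    embDeriv ι p (hι.tangentProj p v) + hι.normalProj hB p v = v := by
  rw [coe_normalProj, add_sub_cancel]

theorem tangentProj_normal [FiniteDimensional ℝ E] (hι : IsIsometricEmbedding g B ι)
    (hB : B.IsSymm) (p : M) (z : normalSub E B ι p) : hι.tangentProj p (z : V) = 0 :=
  hι.eq_zero_of_pairing p fun w ↦ by
    rw [hι.tangentProj_pairing, hB.eq, mem_normalSub_iff.1 z.2]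

theorem normalProj_normal [FiniteDimensional ℝ E] (hι : IsIsometricEmbedding g B ι)
    (hB : B.IsSymm) (p : M) (z : normalSub E B ι p) : hι.normalProj hB p (z : V) = z := by
  ext
  rw [coe_normalProj, hι.tangentProj_normal hB, map_zero, sub_zero]

theorem normalProj_embDeriv [FiniteDimensional ℝ E] (hι : IsIsometricEmbedding g B ι)
    (hB : B.IsSymm) (p : M) (u : TangentSpace 𝓘(ℝ, E) p) :
    hι.normalProj hB p (embDeriv ι p u) = 0 := by
  ext
  rw [coe_normalProj, hι.tangentProj_embDeriv, sub_self, ZeroMemClass.coe_zero]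

/-- Isometries of the tangent spaces and of the normal spaces glue, along the orthogonal
decompositions of `V`, to an isometry of `V`. -/
theorem exists_isometryEquiv [FiniteDimensional ℝ V] [FiniteDimensional ℝ E]
    (hB : B.IsSymm) (hB' : B.Nondegenerate)
    (hι : IsIsometricEmbedding g B ι) (hι' : IsIsometricEmbedding g' B ι') (p : M) (q : M')
    (A : TangentSpace 𝓘(ℝ, E) p →ₗ[ℝ] TangentSpace 𝓘(ℝ, E') q)
    (C : normalSub E B ι p →ₗ[ℝ] normalSub E' B ι' q)
    (hA : ∀ u v, g'.form q (A u) (A v) = g.form p u v) (hC : ∀ y z, B (C y) (C z) = B y z) :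
    ∃ R : B.IsometryEquiv B, (∀ u, R (embDeriv ι p u) = embDeriv ι' q (A u)) ∧
      ∀ z : normalSub E B ι p, R (z : V) = C z := by
  -- `A` on the tangential and `C` on the normal component.
  let R₀ : V →ₗ[ℝ] V := (embDeriv ι' q).toLinearMap ∘ₗ A ∘ₗ hι.tangentProj p +
    (normalSub E' B ι' q).subtype ∘ₗ C ∘ₗ hι.normalProj hB p
  have hR₀ (v : V) : R₀ v = embDeriv ι' q (A (hι.tangentProj p v)) + C (hι.normalProj hB p v) := rfl
  have hiso (v w : V) : B (R₀ v) (R₀ w) = B v w := by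
    rw [hR₀, hR₀, bilin_tangent_add_normal hB, hι'.isometric, hA, hC, ← hι.isometric,
      ← bilin_tangent_add_normal hB, tangentProj_add_normalProj, tangentProj_add_normalProj]
  have hinj : Function.Injective R₀ := (injective_iff_map_eq_zero _).2 fun v hv ↦
    hB'.1 v fun w ↦ by rw [← hiso, hv, map_zero, LinearMap.zero_apply]
  refine ⟨⟨LinearEquiv.ofInjectiveEndo R₀ hinj, hiso⟩, fun u ↦ ?_, fun z ↦ ?_⟩
  · change R₀ _ = _
    rw [hR₀, tangentProj_embDeriv, normalProj_embDeriv, map_zero, ZeroMemClass.coe_zero, add_zero]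
  · change R₀ _ = _
    rw [hR₀, hι.tangentProj_normal hB, normalProj_normal, map_zero, map_zero, zero_add]

end IsIsometricEmbedding

end LinearIsometries

/-! ### The correspondence of rollings -/

section Correspondence

variable {V : Type*} [NormedAddCommGroup V] [NormedSpace ℝ V]
  {E : Type*} [NormedAddCommGroup E] [NormedSpace ℝ E]
  {E' : Type*} [NormedAddCommGroup E'] [NormedSpace ℝ E']
  {M : Type*} [TopologicalSpace M] [ChartedSpace E M]
  {M' : Type*} [TopologicalSpace M'] [ChartedSpace E' M']
  {B : LinearMap.BilinForm ℝ V} {ι : M → V} {ι' : M' → V} {J : Set ℝ} {α : ℝ → M}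

theorem PseudoEuclideanMotion.IsSmoothCurve.contDiffOn_rot_apply [FiniteDimensional ℝ V]
    {F : ℝ → PseudoEuclideanMotion B} (hF : PseudoEuclideanMotion.IsSmoothCurve J F) {W : ℝ → V}
    (hW : ContDiffOn ℝ ∞ W J) : ContDiffOn ℝ ∞ (fun t ↦ (F t).rot (W t)) J := by
  let R : ℝ → V →L[ℝ] V := fun t ↦
    LinearMap.toContinuousLinearMap (F t).rot.toLinearEquiv.toLinearMap
  have hR : ContDiffOn ℝ ∞ R J := contDiffOn_clm_apply.2 hF.1
  exact hR.clm_apply hW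

namespace RollingsCorrespond

variable {α' : ℝ → M'}
  {A : ∀ t, TangentSpace 𝓘(ℝ, E) (α t) →ₗ[ℝ] TangentSpace 𝓘(ℝ, E') (α' t)}
  {C : ∀ t, normalSub E B ι (α t) →ₗ[ℝ] normalSub E' B ι' (α' t)}
  {F : ℝ → PseudoEuclideanMotion B}

theorem development (h : RollingsCorrespond B ι ι' J α α' A C F) {t : ℝ} (ht : t ∈ J) :
    ι' (α' t) = (F t).act (ι (α t)) := by
  rw [PseudoEuclideanMotion.act, h.translation t ht, add_sub_cancel]

/-- The quadruple `(α, α', A, C)` is determined by the motions, as `ι'` and its differentials are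
injective. -/
theorem eq_quadruple (h : RollingsCorrespond B ι ι' J α α' A C F)
    [IsManifold 𝓘(ℝ, E') ∞ M'] {g' : PseudoRiemannianMetric E' M'}
    (hι' : IsIsometricEmbedding g' B ι') {α₁ : ℝ → M'}
    {A₁ : ∀ t, TangentSpace 𝓘(ℝ, E) (α t) →ₗ[ℝ] TangentSpace 𝓘(ℝ, E') (α₁ t)}
    {C₁ : ∀ t, normalSub E B ι (α t) →ₗ[ℝ] normalSub E' B ι' (α₁ t)}
    (h₁ : RollingsCorrespond B ι ι' J α α₁ A₁ C₁ F) {t : ℝ} (ht : t ∈ J) :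
    α₁ t = α' t ∧ HEq (A₁ t) (A t) ∧ HEq (C₁ t) (C t) := by
  have hα : α₁ t = α' t := hι'.isSmoothEmbedding.isEmbedding.injective <| by
    rw [h₁.development ht, h.development ht]
  have hA (u) : embDeriv ι' (α₁ t) (A₁ t u) = embDeriv ι' (α' t) (A t u) := by
    rw [← h₁.tangent t ht, h.tangent t ht]
  have hC (z) : (C₁ t z : V) = C t z := by rw [← h₁.normal t ht, h.normal t ht]
  -- With the values at `t` as variables, `α₁ t = α' t` can be substituted in the types of the maps.
  generalize A₁ t = a₁ at *
  generalize C₁ t = c₁ at *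
  generalize A t = a at *
  generalize C t = c at *
  generalize α₁ t = x₁ at *
  generalize α' t = x at *
  subst hα
  refine ⟨rfl, heq_of_eq (LinearMap.ext fun u ↦ hι'.embDeriv_injective _ (hA u)),
    heq_of_eq (LinearMap.ext fun z ↦ Subtype.ext (hC z))⟩

variable [IsManifold 𝓘(ℝ, E) ∞ M] {g : PseudoRiemannianMetric E M}

/-- The rotation is given by `A` on the tangential and by `C` on the normal component. -/
theorem rot_apply [FiniteDimensional ℝ E] (h : RollingsCorrespond B ι ι' J α α' A C F)
    (hB : B.IsSymm) (hι : IsIsometricEmbedding g B ι) {t : ℝ} (ht : t ∈ J) (v : V) :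
    (F t).rot v = embDeriv ι' (α' t) (A t (hι.tangentProj (α t) v)) +
      C t (hι.normalProj hB (α t) v) := by
  conv_lhs => rw [← hι.tangentProj_add_normalProj hB (α t) v]
  rw [map_add, h.tangent t ht, h.normal t ht]

/-- The motions are determined by `(α, α', A, C)`, as `V` is the sum of the tangent and the normal
space. -/
theorem eqOn_motion [FiniteDimensional ℝ E] {F₁ : ℝ → PseudoEuclideanMotion B}
    (h₁ : RollingsCorrespond B ι ι' J α α' A C F₁) (h : RollingsCorrespond B ι ι' J α α' A C F)
    (hB : B.IsSymm) (hι : IsIsometricEmbedding g B ι) : EqOn F₁ F J := by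
  intro t ht
  have hrot : (F₁ t).rot = (F t).rot := DFunLike.ext _ _ fun v ↦ by
    rw [h₁.rot_apply hB hι ht, h.rot_apply hB hι ht]
  exact PseudoEuclideanMotion.ext hrot (by rw [h₁.translation t ht, h.translation t ht, hrot])

end RollingsCorrespond

variable [IsManifold 𝓘(ℝ, E) ∞ M] [IsManifold 𝓘(ℝ, E') ∞ M']
  {g : PseudoRiemannianMetric E M} {g' : PseudoRiemannianMetric E' M'}

/-- The motion is obtained by gluing `A t` and `C t` at each `t ∈ J`; off `J`, where `A t` and `C t`
need not be isometric, the rotation is the identity. -/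
theorem IsExtrinsicRollingI.exists_motion [FiniteDimensional ℝ V] [FiniteDimensional ℝ E]
    (hB : B.IsSymm) (hB' : B.Nondegenerate)
    (hι : IsIsometricEmbedding g B ι) (hι' : IsIsometricEmbedding g' B ι') {α' : ℝ → M'}
    {A : ∀ t, TangentSpace 𝓘(ℝ, E) (α t) →ₗ[ℝ] TangentSpace 𝓘(ℝ, E') (α' t)}
    {C : ∀ t, normalSub E B ι (α t) →ₗ[ℝ] normalSub E' B ι' (α' t)}
    (h : IsExtrinsicRollingI B g g' ι ι' J α α' A C) :
    ∃ F : ℝ → PseudoEuclideanMotion B, RollingsCorrespond B ι ι' J α α' A C F := by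
  have key (t : ℝ) : ∃ R : B.IsometryEquiv B, t ∈ J →
      (∀ u, R (embDeriv ι (α t) u) = embDeriv ι' (α' t) (A t u)) ∧
        ∀ z : normalSub E B ι (α t), R (z : V) = C t z := by
    by_cases ht : t ∈ J
    · obtain ⟨R, hR⟩ := IsIsometricEmbedding.exists_isometryEquiv hB hB' hι hι' (α t) (α' t)
        (A t) (C t) (h.isometric_tangent t ht) (h.isometric_normal t ht)
      exact ⟨R, fun _ ↦ hR⟩
    · exact ⟨.refl B, fun h ↦ absurd h ht⟩
  choose R hR using key
  exact ⟨fun t ↦ ⟨R t, ι' (α' t) - R t (ι (α t))⟩,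
    fun t ht ↦ (hR t ht).1, fun t ht ↦ (hR t ht).2, fun _ _ ↦ rfl⟩

/-- The motion glued from `A` and `C` is smooth: the tangential and normal components of a smooth
curve in `V` are smooth fields along `α`, which `A` and `C` carry to smooth fields. -/
theorem IsExtrinsicRollingI.isSmoothCurve_motion [FiniteDimensional ℝ V] [FiniteDimensional ℝ E]
    (hB : B.IsSymm) (hι : IsIsometricEmbedding g B ι) (hι' : IsIsometricEmbedding g' B ι')
    {α' : ℝ → M'}
    {A : ∀ t, TangentSpace 𝓘(ℝ, E) (α t) →ₗ[ℝ] TangentSpace 𝓘(ℝ, E') (α' t)}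
    {C : ∀ t, normalSub E B ι (α t) →ₗ[ℝ] normalSub E' B ι' (α' t)}
    {F : ℝ → PseudoEuclideanMotion B} (h : IsExtrinsicRollingI B g g' ι ι' J α α' A C)
    (hF : RollingsCorrespond B ι ι' J α α' A C F) : PseudoEuclideanMotion.IsSmoothCurve J F := by
  have hιs := hι.isSmoothEmbedding.contMDiff
  have hιs' := hι'.isSmoothEmbedding.contMDiff
  have hrot {W : ℝ → V} (hW : ContDiffOn ℝ ∞ W J) :
      ContDiffOn ℝ ∞ (fun t ↦ (F t).rot (W t)) J := by
    have hX : IsSmoothFieldAlong J α fun t ↦ hι.tangentProj (α t) (W t) :=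
      hι.isSmoothFieldAlong_of_pairing h.smooth_curve hW
        fun t _ w ↦ hι.tangentProj_pairing (α t) (W t) w
    have hZ : ContDiffOn ℝ ∞ (fun t ↦ (hι.normalProj hB (α t) (W t) : V)) J :=
      hW.sub (hX.contDiffOn_embDeriv hιs)
    exact (((h.smooth_tangent _ hX).contDiffOn_embDeriv hιs').add
      (h.smooth_normal _ hZ)).congr fun t ht ↦ hF.rot_apply hB hι ht (W t)
  refine ⟨fun v ↦ hrot contDiffOn_const, ?_⟩
  have h1 : ContDiffOn ℝ ∞ (fun t ↦ ι (α t)) J :=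
    (hιs.comp_contMDiffOn h.smooth_curve).contDiffOn
  have h2 : ContDiffOn ℝ ∞ (fun t ↦ ι' (α' t)) J :=
    (hιs'.comp_contMDiffOn h.smooth_development).contDiffOn
  exact (h2.sub (hrot h1)).congr fun t ht ↦ hF.translation t ht

/-- A motion with the given restrictions `A`, `C` inherits the rolling conditions. The parallelism
conditions carry over because a field `X'` with the same image in `V` as `R X` equals `A X` on `J`. -/
theorem IsExtrinsicRollingI.isExtrinsicRollingIIWith [FiniteDimensional ℝ V]
    [FiniteDimensional ℝ E]
    (hB : B.IsSymm) (hι : IsIsometricEmbedding g B ι) (hι' : IsIsometricEmbedding g' B ι')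
    {α' : ℝ → M'}
    {A : ∀ t, TangentSpace 𝓘(ℝ, E) (α t) →ₗ[ℝ] TangentSpace 𝓘(ℝ, E') (α' t)}
    {C : ∀ t, normalSub E B ι (α t) →ₗ[ℝ] normalSub E' B ι' (α' t)}
    {F : ℝ → PseudoEuclideanMotion B} (h : IsExtrinsicRollingI B g g' ι ι' J α α' A C)
    (hF : RollingsCorrespond B ι ι' J α α' A C F) :
    IsExtrinsicRollingIIWith B g g' ι ι' J α F α' where
  smooth_curve := h.smooth_curve
  smooth_motion := h.isSmoothCurve_motion hB hι hι' hF
  development t ht := hF.development ht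
  map_tangent t ht := by
    ext x
    constructor
    · rintro ⟨_, ⟨u, rfl⟩, rfl⟩
      exact ⟨A t u, (hF.tangent t ht u).symm.trans ((F t).diff_apply _ _).symm⟩
    · rintro ⟨x, rfl⟩
      obtain ⟨u, rfl⟩ := (h.bijective_tangent t ht).2 x
      exact ⟨_, ⟨u, rfl⟩, ((F t).diff_apply _ _).trans (hF.tangent t ht u)⟩
  no_slip t ht := by
    rw [PseudoEuclideanMotion.diff_apply, hF.tangent t ht, h.no_slip t ht]
  no_twist_tangent X X' hX := by
    refine (isParallelAlong_congr g' fun t ht ↦ hι'.embDeriv_injective _ ?_).trans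
      (h.no_twist_tangent X)
    rw [hX t ht, PseudoEuclideanMotion.diff_apply, hF.tangent t ht]
  no_twist_normal Z :=
    (isNormalParallelAlong_congr B ι' α' fun t ht ↦
      ((F t).diff_apply _ _).trans (hF.normal t ht (Z t))).trans (h.no_twist_normal Z)

namespace IsExtrinsicRollingIIWith

variable [FiniteDimensional ℝ V] {α' : ℝ → M'} {F : ℝ → PseudoEuclideanMotion B}

theorem rot_mem_tangentSub (h : IsExtrinsicRollingIIWith B g g' ι ι' J α F α') {t : ℝ}
    (ht : t ∈ J) (u : TangentSpace 𝓘(ℝ, E) (α t)) :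
    ∃ u' : TangentSpace 𝓘(ℝ, E') (α' t),
      embDeriv ι' (α' t) u' = (F t).rot (embDeriv ι (α t) u) := by
  have : (F t).diff (ι (α t)) (embDeriv ι (α t) u) ∈ tangentSub E' ι' (α' t) := by
    rw [← h.map_tangent t ht]
    exact ⟨_, ⟨u, rfl⟩, rfl⟩
  rwa [PseudoEuclideanMotion.diff_apply] at this

theorem exists_rot_eq (h : IsExtrinsicRollingIIWith B g g' ι ι' J α F α') {t : ℝ}
    (ht : t ∈ J) (u' : TangentSpace 𝓘(ℝ, E') (α' t)) :
    ∃ u : TangentSpace 𝓘(ℝ, E) (α t),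
      (F t).rot (embDeriv ι (α t) u) = embDeriv ι' (α' t) u' := by
  have : embDeriv ι' (α' t) u' ∈ tangentSub E' ι' (α' t) := ⟨u', rfl⟩
  rw [← h.map_tangent t ht] at this
  obtain ⟨_, ⟨u, rfl⟩, hu⟩ := this
  exact ⟨u, ((F t).diff_apply _ _).symm.trans hu⟩

/-- As `R t` is an isometry carrying tangent space onto tangent space, it does so for the normal
spaces. -/
theorem rot_mem_normalSub_iff (h : IsExtrinsicRollingIIWith B g g' ι ι' J α F α') {t : ℝ}
    (ht : t ∈ J) (z : V) :
    (F t).rot z ∈ normalSub E' B ι' (α' t) ↔ z ∈ normalSub E B ι (α t) := by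
  rw [mem_normalSub_iff, mem_normalSub_iff]
  constructor
  · intro hz u
    obtain ⟨u', hu'⟩ := h.rot_mem_tangentSub ht u
    have := hz u'
    rwa [hu', LinearMap.BilinForm.IsometryEquiv.map_app] at this
  · intro hz u'
    obtain ⟨u, hu⟩ := h.exists_rot_eq ht u'
    rw [← hu, LinearMap.BilinForm.IsometryEquiv.map_app, hz]

/-- The rotations of a rolling (II) restrict to the tangent and normal spaces. The restriction to the
tangent space is recovered from `V` by the tangential projection of `M'`. -/
theorem exists_quadruple [FiniteDimensional ℝ E']
    (h : IsExtrinsicRollingIIWith B g g' ι ι' J α F α') (hι' : IsIsometricEmbedding g' B ι') :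
    ∃ (A : ∀ t, TangentSpace 𝓘(ℝ, E) (α t) →ₗ[ℝ] TangentSpace 𝓘(ℝ, E') (α' t))
      (C : ∀ t, normalSub E B ι (α t) →ₗ[ℝ] normalSub E' B ι' (α' t)),
      RollingsCorrespond B ι ι' J α α' A C F := by
  have hC (t : ℝ) : ∃ c : normalSub E B ι (α t) →ₗ[ℝ] normalSub E' B ι' (α' t),
      t ∈ J → ∀ z : normalSub E B ι (α t), (F t).rot (z : V) = c z := by
    by_cases ht : t ∈ J
    · exact ⟨(F t).rot.toLinearEquiv.toLinearMap.restrict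
        fun z hz ↦ (h.rot_mem_normalSub_iff ht z).2 hz, fun _ _ ↦ rfl⟩
    · exact ⟨0, fun h ↦ absurd h ht⟩
  choose C hC using hC
  refine ⟨fun t ↦ hι'.tangentProj (α' t) ∘ₗ (F t).rot.toLinearEquiv.toLinearMap ∘ₗ
    (embDeriv ι (α t)).toLinearMap, C, fun t ht u ↦ ?_, hC, fun t ht ↦ ?_⟩
  · obtain ⟨u', hu'⟩ := h.rot_mem_tangentSub ht u
    change _ = embDeriv ι' (α' t) (hι'.tangentProj (α' t) ((F t).rot (embDeriv ι (α t) u)))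
    rw [← hu', hι'.tangentProj_embDeriv]
  · rw [h.development t ht, PseudoEuclideanMotion.act, add_sub_cancel_left]

/-- The development curve is smooth in `V`, hence in `M'` because `ι'` is an embedding. -/
theorem smooth_development (h : IsExtrinsicRollingIIWith B g g' ι ι' J α F α')
    (hι : IsIsometricEmbedding g B ι) (hι' : IsIsometricEmbedding g' B ι') :
    IsSmoothCurve E' J α' := by
  refine isSmoothCurve_of_contDiffOn_embedding hι'.isSmoothEmbedding ?_
  have h1 : ContDiffOn ℝ ∞ (fun t ↦ ι (α t)) J :=
    (hι.isSmoothEmbedding.contMDiff.comp_contMDiffOn h.smooth_curve).contDiffOn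
  exact ((h.smooth_motion.contDiffOn_rot_apply h1).add h.smooth_motion.2).congr
    fun t ht ↦ h.development t ht

/-- The restrictions of the rotations of a rolling (II) form a rolling (I). Smoothness of `A X` along
`α'` follows from that of its image `R X` in `V`. -/
theorem isExtrinsicRollingI [FiniteDimensional ℝ E']
    {A : ∀ t, TangentSpace 𝓘(ℝ, E) (α t) →ₗ[ℝ] TangentSpace 𝓘(ℝ, E') (α' t)}
    {C : ∀ t, normalSub E B ι (α t) →ₗ[ℝ] normalSub E' B ι' (α' t)}
    (h : IsExtrinsicRollingIIWith B g g' ι ι' J α F α')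
    (hι : IsIsometricEmbedding g B ι) (hι' : IsIsometricEmbedding g' B ι')
    (hF : RollingsCorrespond B ι ι' J α α' A C F) :
    IsExtrinsicRollingI B g g' ι ι' J α α' A C where
  smooth_curve := h.smooth_curve
  smooth_development := h.smooth_development hι hι'
  smooth_tangent X hX :=
    hι'.isSmoothFieldAlong_of_pairing (h.smooth_development hι hι')
      (h.smooth_motion.contDiffOn_rot_apply
        (hX.contDiffOn_embDeriv hι.isSmoothEmbedding.contMDiff))
      fun t ht w ↦ by rw [hF.tangent t ht]
  smooth_normal Z hZ :=
    (h.smooth_motion.contDiffOn_rot_apply hZ).congr fun t ht ↦ (hF.normal t ht (Z t)).symm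
  bijective_tangent t ht := by
    constructor
    · intro u v huv
      apply hι.embDeriv_injective (α t)
      apply (F t).rot.toLinearEquiv.injective
      exact (hF.tangent t ht u).trans ((congrArg _ huv).trans (hF.tangent t ht v).symm)
    · intro u'
      obtain ⟨u, hu⟩ := h.exists_rot_eq ht u'
      exact ⟨u, hι'.embDeriv_injective _ ((hF.tangent t ht u).symm.trans hu)⟩
  isometric_tangent t ht u v := by
    rw [← hι'.isometric, ← hF.tangent t ht, ← hF.tangent t ht,
      LinearMap.BilinForm.IsometryEquiv.map_app, hι.isometric]
  bijective_normal t ht := by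
    constructor
    · intro y z hyz
      apply Subtype.ext
      apply (F t).rot.toLinearEquiv.injective
      exact (hF.normal t ht y).trans ((congrArg _ hyz).trans (hF.normal t ht z).symm)
    · intro z'
      obtain ⟨z, hz⟩ : ∃ z, (F t).rot z = (z' : V) := (F t).rot.toLinearEquiv.surjective z'
      have hzN : z ∈ normalSub E B ι (α t) := (h.rot_mem_normalSub_iff ht z).1 (hz ▸ z'.2)
      exact ⟨⟨z, hzN⟩, Subtype.ext ((hF.normal t ht ⟨z, hzN⟩).symm.trans hz)⟩
  isometric_normal t ht y z := by
    rw [← hF.normal t ht, ← hF.normal t ht, LinearMap.BilinForm.IsometryEquiv.map_app]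
  no_slip t ht := hι'.embDeriv_injective _ <| by
    rw [h.no_slip t ht, PseudoEuclideanMotion.diff_apply, hF.tangent t ht]
  no_twist_tangent X := h.no_twist_tangent X _ fun t ht ↦ by
    rw [PseudoEuclideanMotion.diff_apply, hF.tangent t ht]
  no_twist_normal Z :=
    (isNormalParallelAlong_congr B ι' α' fun t ht ↦
      (hF.normal t ht (Z t)).symm.trans ((F t).diff_apply _ _).symm).trans (h.no_twist_normal Z)

end IsExtrinsicRollingIIWith

end Correspondence

theorem mainTheorem10
    {V : Type*} [NormedAddCommGroup V] [NormedSpace ℝ V] [FiniteDimensional ℝ V]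
    (B : LinearMap.BilinForm ℝ V) (hB_symm : B.IsSymm) (hB_nondeg : B.Nondegenerate)
    {E : Type*} [NormedAddCommGroup E] [NormedSpace ℝ E] [FiniteDimensional ℝ E]
    {E' : Type*} [NormedAddCommGroup E'] [NormedSpace ℝ E'] [FiniteDimensional ℝ E']
    {M : Type*} [TopologicalSpace M] [ChartedSpace E M] [IsManifold 𝓘(ℝ, E) ∞ M]
    {M' : Type*} [TopologicalSpace M'] [ChartedSpace E' M'] [IsManifold 𝓘(ℝ, E') ∞ M']
    (g : PseudoRiemannianMetric E M) (g' : PseudoRiemannianMetric E' M')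
    (ι : M → V) (hι : IsIsometricEmbedding g B ι)
    (ι' : M' → V) (hι' : IsIsometricEmbedding g' B ι')
    (J : Set ℝ) (hJ : J.OrdConnected) (hJ_nontrivial : J.Nontrivial) (α : ℝ → M) :
    -- every rolling (I) gives a rolling (II) by the formulas, which determine it on `J`
    (∀ (α' : ℝ → M')
        (A : ∀ t, TangentSpace 𝓘(ℝ, E) (α t) →ₗ[ℝ] TangentSpace 𝓘(ℝ, E') (α' t))
        (C : ∀ t, normalSub E B ι (α t) →ₗ[ℝ] normalSub E' B ι' (α' t)),
      IsExtrinsicRollingI B g g' ι ι' J α α' A C →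
        ∃ F : ℝ → PseudoEuclideanMotion B,
          RollingsCorrespond B ι ι' J α α' A C F ∧
          IsExtrinsicRollingII B g g' ι ι' J α F ∧
          ∀ F₁ : ℝ → PseudoEuclideanMotion B,
            RollingsCorrespond B ι ι' J α α' A C F₁ → EqOn F₁ F J) ∧
    -- every rolling (II) gives a rolling (I) by the formulas, which determine it on `J`
    (∀ F : ℝ → PseudoEuclideanMotion B,
      IsExtrinsicRollingII B g g' ι ι' J α F →
        ∃ (α' : ℝ → M')
          (A : ∀ t, TangentSpace 𝓘(ℝ, E) (α t) →ₗ[ℝ] TangentSpace 𝓘(ℝ, E') (α' t))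
          (C : ∀ t, normalSub E B ι (α t) →ₗ[ℝ] normalSub E' B ι' (α' t)),
          RollingsCorrespond B ι ι' J α α' A C F ∧
          IsExtrinsicRollingI B g g' ι ι' J α α' A C ∧
          ∀ (α₁ : ℝ → M')
            (A₁ : ∀ t, TangentSpace 𝓘(ℝ, E) (α t) →ₗ[ℝ] TangentSpace 𝓘(ℝ, E') (α₁ t))
            (C₁ : ∀ t, normalSub E B ι (α t) →ₗ[ℝ] normalSub E' B ι' (α₁ t)),
            RollingsCorrespond B ι ι' J α α₁ A₁ C₁ F →
              ∀ t ∈ J, α₁ t = α' t ∧ HEq (A₁ t) (A t) ∧ HEq (C₁ t) (C t)) := by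
  refine ⟨fun α' A C h ↦ ?_, ?_⟩
  · obtain ⟨F, hF⟩ := h.exists_motion hB_symm hB_nondeg hι hι'
    exact ⟨F, hF, ⟨α', h.isExtrinsicRollingIIWith hB_symm hι hι' hF⟩,
      fun F₁ hF₁ ↦ hF₁.eqOn_motion hF hB_symm hι⟩
  · rintro F ⟨α', h⟩
    obtain ⟨A, C, hF⟩ := h.exists_quadruple hι'
    exact ⟨α', A, C, hF, h.isExtrinsicRollingI hι hι' hF,
      fun α₁ A₁ C₁ h₁ t ht ↦ hF.eq_quadruple hι' h₁ ht⟩
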